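/- **Conventions.** $\mathbb N=\{1,2,\dots\}$. For a group $\Gamma$ with a finite symmetric generating set $S$, $\gamma_\Gamma^S(n)$ is the number of elements of $\Gamma$ that are products of at most $n$ elements of $S$. A function $f:\mathbb N\to\mathbb N$ is *admissible* if it is (weakly) increasing, subexponential (that is, $\log f(n)/n\to0$), and $n/\log f(n)$ is (weakly) increasing (on the set of $n$ with $f(n)>1$, where the ratio is defined). A *marked group* is a group $H$ with an ordered generating quadruple $(a,b,c,d)$ satisfying $a^2=b^2=c^2=d^2=bcd=1$. The *marked product* of a family $(G_i)$ of marked groups is the subgroup of $\prod_i G_i$ generated by the four elements $(a_i)_i,(b_i)_i,(c_i)_i,(d_i)_i$, marked by these elements. For $x\in\{0,1,2\}$ and a marked group $H$, $F_x(H)$ is the subgroup of $H\wr\mathbb Z_2=\mathbb Z_2\ltimes(H\times H)$ marked and generated by $A=(\xi;1,1)$, $B=(1;\beta_x,b)$, $C=(1;\kappa_x,c)$, $D=(1;\delta_x,d)$, where $\xi$ generates $\mathbb Z_2$ and $$(\beta_x,\kappa_x,\delta_x)=(a,a,1),\ (a,1,a),\ (1,a,a)\quad\text{for } x=0,1,2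 \text{ respectively.}$$ For an infinite word $\omega=x_1x_2\cdots$ over $\{0,1,2\}$ put $F^m_\omega(H)=F_{x_1}(F_{x_2}(\cdots F_{x_m}(H)\cdots))$. The *Grigorchuk group* $\mathbf G_\omega$ is the group of automorphisms of the rooted binary tree generated by $a,b_\omega,c_\omega,d_\omega$, where $a$ exchanges the two subtrees below the root and, writing $\omega=x\omega'$, the automorphisms $b_\omega=(\beta_x,b_{\omega'})$, $c_\omega=(\kappa_x,c_{\omega'})$, $d_\omega=(\delta_x,d_{\omega'})$ fix the two children of the root and act on the two subtrees below it as indicated. Let $\gamma_{\mathbf G_\omega}$ be its growth function with respect to $\{a,b_\omega,c_\omega,d_\omega\}$. **Theorem.** Let $\omega$ be an infinite word over $\{0,1,2\}$ that is not eventually constant. Let $f,g:\mathbb N\to\mathbb N$ be admissible functions such that $\lim_{n\to\infty} g(n)/\gamma_{\mathbf G_\omega}(n)=\infty$, and let $(a_i)$, $(b_i)$ be sequences of integers with $a_i\to\infty$ and $b_i\to\infty$. Then there exist a finitely generated group $\Gamma$ and a finite symmetric generating set $S$ of $\Gamma$ such that $$\gamma_\Gamma^S(n)<g(n)\ \text{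 for infinitely many } n\in\{b_i\},\qquad \gamma_\Gamma^S(n)>f(n)\ \text{ for infinitely many } n\in\{a_i\}.$$ Moreover, $\Gamma$ with its generating set $S$ can be taken to be the marked product of the groups $F^{m_i}_\omega(H_i)$, $i\ge1$, for some strictly increasing sequences of integers $m_i\ge0$ and of primes $p_i\equiv1\pmod 4$, where $H_i=\mathrm{PSL}_2(p_i)$ with a suitable marking. -/

import Mathlib

open Filter

/-! ### Growth functions and admissible functions -/

/-- The ball of radius `n` for a symmetric generating set `S`: products of at most `n` elements
of `S`. -/
def wordBall {G : Type*} [Group G] (S : Set G) (n : ℕ) : Set G :=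
  {x | ∃ l : List G, l.length ≤ n ∧ (∀ s ∈ l, s ∈ S) ∧ l.prod = x}

/-- The growth function `n ↦ |B(n)|`. -/
noncomputable def growth {G : Type*} [Group G] (S : Set G) (n : ℕ) : ℕ :=
  (wordBall S n).ncard

/-- Admissible functions on the positive integers (the value at `0` plays no role): increasing,
subexponential, with `n / log f n` increasing (wherever the ratio is defined). -/
structure Admissible (f : ℕ → ℝ) : Prop where
  one_le : ∀ n, 1 ≤ n → 1 ≤ f n
  increasing : MonotoneOn f {n | 1 ≤ n}
  subexponential : Tendsto (fun n : ℕ => Real.log (f n) / n) atTop (nhds 0)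
  ratio_increasing : MonotoneOn (fun n : ℕ => (n : ℝ) / Real.log (f n)) {n | 1 ≤ n ∧ 1 < f n}

/-! ### Marked groups -/

/-- A group with an ordered generating quadruple `(a, b, c, d)` such that
`a² = b² = c² = d² = bcd = 1`, i.e. an epimorphic image of the group
`⟨a, b, c, d | a² = b² = c² = d² = bcd = 1⟩`. -/
structure MarkedGroup : Type 1 where
  carrier : Type
  [group : Group carrier]
  a : carrier
  b : carrier
  c : carrier
  d : carrier
  a_sq : a * a = 1
  b_sq : b * b = 1
  c_sq : c * c = 1
  d_sq : d * d = 1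
  bcd : b * c * d = 1
  closure_eq_top : Subgroup.closure {a, b, c, d} = ⊤

attribute [instance] MarkedGroup.group

namespace MarkedGroup

/-- The marking as a set. -/
def gens (H : MarkedGroup) : Set H.carrier := {H.a, H.b, H.c, H.d}

/-- The marked subgroup of `G` generated by four elements satisfying the relations. -/
def ofGenerators {G : Type} [Group G] (a b c d : G) (ha : a * a = 1) (hb : b * b = 1)
    (hc : c * c = 1) (hd : d * d = 1) (hbcd : b * c * d = 1) : MarkedGroup where
  carrier := Subgroup.closure ({a, b, c, d} : Set G)
  a := ⟨a, Subgroup.subset_closure (by simp)⟩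
  b := ⟨b, Subgroup.subset_closure (by simp)⟩
  c := ⟨c, Subgroup.subset_closure (by simp)⟩
  d := ⟨d, Subgroup.subset_closure (by simp)⟩
  a_sq := Subtype.ext ha
  b_sq := Subtype.ext hb
  c_sq := Subtype.ext hc
  d_sq := Subtype.ext hd
  bcd := Subtype.ext hbcd
  closure_eq_top := by
    rw [← Subgroup.closure_closure_coe_preimage (k := ({a, b, c, d} : Set G))]
    congr 1
    ext ⟨x, hx⟩
    simp

/-- The marked product of a family: the subgroup of the full direct product generated by the
diagonally embedded markings. -/
def product {I : Type} (G : I → MarkedGroup) : MarkedGroup :=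
  ofGenerators (G := ∀ i, (G i).carrier)
    (fun i => (G i).a) (fun i => (G i).b) (fun i => (G i).c) (fun i => (G i).d)
    (funext fun i => (G i).a_sq) (funext fun i => (G i).b_sq) (funext fun i => (G i).c_sq)
    (funext fun i => (G i).d_sq) (funext fun i => (G i).bcd)

/-- The cyclic group of order two. -/
abbrev C2 : Type := Multiplicative (ZMod 2)

/-- The element `(1; u, v)` of the wreath product `H ≀ C2`. -/
def pair {H : Type} (u v : H) : RegularWreathProduct H C2 :=
  ⟨fun q => if q = 1 then u else v, 1⟩

/-- The element `(ξ; 1, 1)` of `H ≀ C2`, where `ξ` generates `C2`. -/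
def swap (H : Type) [Group H] : RegularWreathProduct H C2 :=
  ⟨1, Multiplicative.ofAdd 1⟩

theorem pair_mul {H : Type} [Group H] (u v u' v' : H) :
    pair u v * pair u' v' = pair (u * u') (v * v') := by
  ext q
  · by_cases h : q = 1 <;> simp [pair, h]
  · simp [pair]

theorem pair_one (H : Type) [Group H] : pair (1 : H) 1 = 1 := by
  ext q <;> simp [pair]

theorem swap_mul_swap (H : Type) [Group H] : swap H * swap H = 1 := by
  ext q
  · simp [swap]
  · have h : (Multiplicative.ofAdd 1 : C2) * Multiplicative.ofAdd 1 = 1 := by decide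
    simp [swap, h]

/-- The functor `F_x`, `x ∈ {0, 1, 2}`: the subgroup of `H ≀ C2` generated by `A = (ξ; 1, 1)` and
* `B = (1; a, b)`, `C = (1; a, c)`, `D = (1; 1, d)` if `x = 0`,
* `B = (1; a, b)`, `C = (1; 1, c)`, `D = (1; a, d)` if `x = 1`,
* `B = (1; 1, b)`, `C = (1; a, c)`, `D = (1; a, d)` if `x = 2`. -/
def F (x : Fin 3) (H : MarkedGroup) : MarkedGroup :=
  ofGenerators (swap H.carrier)
    (pair (if x = 2 then 1 else H.a) H.b)
    (pair (if x = 1 then 1 else H.a) H.c)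
    (pair (if x = 0 then 1 else H.a) H.d)
    (swap_mul_swap _)
    (by rw [pair_mul, H.b_sq]; split_ifs <;> simp [H.a_sq, pair_one])
    (by rw [pair_mul, H.c_sq]; split_ifs <;> simp [H.a_sq, pair_one])
    (by rw [pair_mul, H.d_sq]; split_ifs <;> simp [H.a_sq, pair_one])
    (by
      rw [pair_mul, pair_mul, H.bcd]
      fin_cases x <;> simp [H.a_sq, pair_one])

/-- `F^k_ω (H) = F_{ω 0} (F_{ω 1} (⋯ F_{ω (k-1)} (H) ⋯))`. -/
def Fpow : (ℕ → Fin 3) → ℕ → MarkedGroup → MarkedGroup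
  | _, 0, H => H
  | ω, k + 1, H => F (ω 0) (Fpow (fun n => ω (n + 1)) k H)

end MarkedGroup

/-! ### The Grigorchuk groups, acting on the vertices of the rooted binary tree -/

/-- Exchange of the two subtrees below the root. -/
def treeFlip : List Bool → List Bool
  | [] => []
  | x :: v => (!x) :: v

theorem treeFlip_involutive : Function.Involutive treeFlip
  | [] => rfl
  | x :: v => by simp [treeFlip]

/-- For `ω ∈ {0,1,2}^ℕ` and a letter `t`, the automorphism `(u, s)` of the binary tree, where
`u` is trivial if `ω 0 = t` and is the exchange otherwise, and `s` is the automorphism for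
the shifted sequence and the same letter. -/
def treeBranch (t : Fin 3) : (ℕ → Fin 3) → List Bool → List Bool
  | _, [] => []
  | ω, false :: v => false :: (if ω 0 = t then v else treeFlip v)
  | ω, true :: v => true :: treeBranch t (fun n => ω (n + 1)) v

theorem treeBranch_involutive (t : Fin 3) (ω : ℕ → Fin 3) :
    Function.Involutive (treeBranch t ω) := by
  intro v
  induction v generalizing ω with
  | nil => rfl
  | cons x v ih =>
    cases x
    · by_cases h : ω 0 = t <;> simp [treeBranch, h, treeFlip_involutive v]
    · simp [treeBranch, ih]

theorem treeBranch_relation (ω : ℕ → Fin 3) (v : List Bool) :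
    treeBranch 2 ω (treeBranch 1 ω (treeBranch 0 ω v)) = v := by
  induction v generalizing ω with
  | nil => rfl
  | cons x v ih =>
    cases x
    · obtain h | h | h : ω 0 = 0 ∨ ω 0 = 1 ∨ ω 0 = 2 := by
        generalize ω 0 = y
        fin_cases y <;> simp
      all_goals simp [treeBranch, h, treeFlip_involutive v]
    · simp [treeBranch, ih]

/-- The Grigorchuk group `G_ω` with its standard marking: `a` exchanges the two subtrees, and
`b`, `c`, `d` are the automorphisms `treeBranch` for the letters `2`, `1`, `0`. -/
def grigorchuk (ω : ℕ → Fin 3) : MarkedGroup :=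
  MarkedGroup.ofGenerators (G := Equiv.Perm (List Bool))
    treeFlip_involutive.toPerm
    (treeBranch_involutive 2 ω).toPerm
    (treeBranch_involutive 1 ω).toPerm
    (treeBranch_involutive 0 ω).toPerm
    (Equiv.ext treeFlip_involutive)
    (Equiv.ext (treeBranch_involutive 2 ω))
    (Equiv.ext (treeBranch_involutive 1 ω))
    (Equiv.ext (treeBranch_involutive 0 ω))
    (Equiv.ext (treeBranch_relation ω))

/-- The infinite word `ω` is not eventually constant. -/
def NonStabilizing (ω : ℕ → Fin 3) : Prop :=
  ∀ x : Fin 3, ∀ N : ℕ, ∃ n, N ≤ n ∧ ω n ≠ x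

/-!
A relation of length at most `2 ^ m` of the Grigorchuk group `G_ω` holds in `F^m_ω (H)` for every
marked group `H`: passing to the two sections of a reduced word roughly halves its length, and since
`ω` is not eventually constant no single letter is trivial in a Grigorchuk group
(`Fpow_eval_eq_one_of_grigorchuk`). Hence, if the first `k` factors of the marked product `Γ` are
finite of total order `C` and the later ones have `2 ^ m i ≥ 2 * n`, then the `n`-ball of `Γ` has
at most `C` times as many elements as that of `G_ω` (`growth_product_le`). As `g` exceeds every
constant multiple of the growth of `G_ω` eventually, this gives the upper bound at some `n` among the
`b i`, provided `m k` is chosen large after the first `k` factors and `n`.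

For the lower bound, `m` is fixed and `p` grows. The involutions of `PSL₂(p)` chosen here have
products of length two and four equal to the two unitriangular matrices with entry `1`. Over `ℕ`
these generate a free monoid, which persists modulo `p` for products of `k` factors with
`2 ^ (k + 1) < p`; so the ball of radius `4 * k` has at least `2 ^ k` elements
(`PSLMarking.two_pow_le_growth_markedPSL`). Words of `H` lift to words of `F x H` at most
three times as long (`MarkedGroup.growth_le_growth_Fpow`), and thus for `p` large the growth of
`F^m_ω (H)` at `n` is at least `2 ^ (n / (4 * 3 ^ m))`, which exceeds the subexponential function `f`
at some `n` among the `a i`. The sequences `m i`, `p i` are obtained by alternating these two choices.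
-/

/-! ### Words in the marking -/

/-- The letters of a word in the marking: `none` stands for `a`, and `some 2`, `some 1`, `some 0`
for `b`, `c`, `d`. With this numbering `some t` has trivial first coordinate under `F x` exactly
when `x = t`, and it acts on the tree as `treeBranch t`. -/
abbrev MarkingLetter : Type := Option (Fin 3)

namespace MarkedGroup

/-- The generator of a marked group named by a letter. -/
def letter (H : MarkedGroup) : MarkingLetter → H.carrier
  | none => H.a
  | some 0 => H.d
  | some 1 => H.c
  | some 2 => H.b

/-- The element of a marked group represented by a word. -/
def eval (H : MarkedGroup) (w : List MarkingLetter) : H.carrier := (w.map H.letter).prod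

@[simp] theorem eval_nil (H : MarkedGroup) : H.eval [] = 1 := rfl

@[simp] theorem eval_cons (H : MarkedGroup) (l : MarkingLetter) (w : List MarkingLetter) :
    H.eval (l :: w) = H.letter l * H.eval w := by simp [eval]

@[simp] theorem eval_append (H : MarkedGroup) (u v : List MarkingLetter) :
    H.eval (u ++ v) = H.eval u * H.eval v := by simp [eval]

theorem letter_mul_self (H : MarkedGroup) (l : MarkingLetter) : H.letter l * H.letter l = 1 := by
  obtain _ | t := l
  · exact H.a_sq
  · fin_cases t
    exacts [H.d_sq, H.c_sq, H.b_sq]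

theorem inv_letter (H : MarkedGroup) (l : MarkingLetter) : (H.letter l)⁻¹ = H.letter l :=
  inv_eq_of_mul_eq_one_left (H.letter_mul_self l)

@[simp] theorem eval_reverse (H : MarkedGroup) (w : List MarkingLetter) :
    H.eval w.reverse = (H.eval w)⁻¹ := by
  induction w with
  | nil => simp
  | cons l w ih => simp [ih, inv_letter]

theorem eval_reverse_append_eq_one_iff (H : MarkedGroup) (u v : List MarkingLetter) :
    H.eval (u.reverse ++ v) = 1 ↔ H.eval u = H.eval v := by
  rw [eval_append, eval_reverse, inv_mul_eq_one]

/-- Since `bcd = 1` and `b`, `c`, `d` are involutions, the product of two distinct ones among them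
is the third. Its index is `-(s + t)` because `0 + 1 + 2 = 0` in `Fin 3`. -/
theorem letter_mul_letter (H : MarkedGroup) {s t : Fin 3} (h : s ≠ t) :
    H.letter (some s) * H.letter (some t) = H.letter (some (-(s + t))) := by
  have hb : H.b⁻¹ = H.b := H.inv_letter (some 2)
  have hc : H.c⁻¹ = H.c := H.inv_letter (some 1)
  have hd : H.d⁻¹ = H.d := H.inv_letter (some 0)
  have hbc : H.b * H.c = H.d := by rw [← hd]; exact eq_inv_of_mul_eq_one_left H.bcd
  have hcb : H.c * H.b = H.d := by rw [← hd, ← hbc, mul_inv_rev, hb, hc]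
  have hdc : H.d * H.c = H.b := by rw [← hbc, mul_assoc, H.c_sq, mul_one]
  have hdb : H.d * H.b = H.c := by rw [← hcb, mul_assoc, H.b_sq, mul_one]
  have hcd : H.c * H.d = H.b := by rw [← hcb, ← mul_assoc, H.c_sq, one_mul]
  have hbd : H.b * H.d = H.c := by rw [← hbc, ← mul_assoc, H.b_sq, one_mul]
  fin_cases s <;> fin_cases t <;> first | exact absurd rfl h | assumption

theorem range_letter (H : MarkedGroup) : Set.range H.letter = H.gens := by
  ext x
  simp only [gens, Set.mem_range, Set.mem_insert_iff, Set.mem_singleton_iff]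
  constructor
  · rintro ⟨_ | t, rfl⟩
    · exact Or.inl rfl
    · fin_cases t
      exacts [Or.inr (Or.inr (Or.inr rfl)), Or.inr (Or.inr (Or.inl rfl)), Or.inr (Or.inl rfl)]
  · rintro (rfl | rfl | rfl | rfl)
    exacts [⟨none, rfl⟩, ⟨some 2, rfl⟩, ⟨some 1, rfl⟩, ⟨some 0, rfl⟩]

theorem wordBall_gens (H : MarkedGroup) (n : ℕ) :
    wordBall H.gens n = H.eval '' {w | w.length ≤ n} := by
  ext x
  constructor
  · rintro ⟨l, hl, hS, rfl⟩
    have : ∃ w : List MarkingLetter, w.map H.letter = l := by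
      rw [← Set.mem_range, Set.range_list_map, H.range_letter]
      exact hS
    obtain ⟨w, rfl⟩ := this
    exact ⟨w, by simpa using hl, rfl⟩
  · rintro ⟨w, hw, rfl⟩
    refine ⟨w.map H.letter, by simpa using hw, fun s hs => ?_, rfl⟩
    obtain ⟨l, -, rfl⟩ := List.mem_map.1 hs
    exact H.range_letter ▸ Set.mem_range_self l

theorem finite_words (n : ℕ) : {w : List MarkingLetter | w.length ≤ n}.Finite :=
  List.finite_length_le _ n

theorem finite_wordBall (H : MarkedGroup) (n : ℕ) : (wordBall H.gens n).Finite := by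
  rw [wordBall_gens]
  exact (finite_words n).image _

theorem growth_pos (H : MarkedGroup) (n : ℕ) : 0 < growth H.gens n :=
  (Set.ncard_pos (H.finite_wordBall n)).2 ⟨1, [], by simp, by simp, rfl⟩

theorem growth_mono (H : MarkedGroup) {m n : ℕ} (h : m ≤ n) :
    growth H.gens m ≤ growth H.gens n :=
  Set.ncard_le_ncard (fun _ ⟨l, hl, h'⟩ => ⟨l, hl.trans h, h'⟩) (H.finite_wordBall n)

end MarkedGroup

theorem Set.ncard_image_le_ncard_image {α β γ : Type*} {s : Set α} (hs : s.Finite)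
    {f : α → β} {g : α → γ} (h : ∀ x ∈ s, ∀ y ∈ s, g x = g y → f x = f y) :
    (f '' s).ncard ≤ (g '' s).ncard := by
  obtain rfl | ⟨x₀, -⟩ := s.eq_empty_or_nonempty
  · simp
  have : Nonempty α := ⟨x₀⟩
  choose! r hr hrg using fun z (hz : z ∈ g '' s) => hz
  refine (Set.ncard_le_ncard ?_ ((hs.image g).image (fun z => f (r z)))).trans
    (Set.ncard_image_le (hs.image g))
  rintro _ ⟨x, hx, rfl⟩
  exact ⟨g x, ⟨x, hx, rfl⟩, h _ (hr _ ⟨x, hx, rfl⟩) _ hx (hrg _ ⟨x, hx, rfl⟩)⟩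

namespace MarkedGroup

/-- A translation of words that stretches lengths in a controlled way and reflects equality of the
represented elements gives an inequality between growth functions. -/
theorem growth_le_growth_of_translation {H K : MarkedGroup} {n n' : ℕ}
    (φ : List MarkingLetter → List MarkingLetter)
    (hφ : ∀ w, w.length ≤ n → (φ w).length ≤ n')
    (h : ∀ u v, K.eval (φ u) = K.eval (φ v) → H.eval u = H.eval v) :
    growth H.gens n ≤ growth K.gens n' := by
  rw [growth, growth, H.wordBall_gens, K.wordBall_gens]
  refine (Set.ncard_image_le_ncard_image (finite_words n) (g := fun w => K.eval (φ w))
    fun u _ v _ => h u v).trans (Set.ncard_le_ncard ?_ ((finite_words n').image _))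
  rintro _ ⟨w, hw, rfl⟩
  exact ⟨φ w, hφ w hw, rfl⟩

theorem product_eval_apply {I : Type} (G : I → MarkedGroup) (w : List MarkingLetter) (i : I) :
    ((product G).eval w).1 i = (G i).eval w := by
  induction w with
  | nil => rfl
  | cons l w ih =>
    rw [eval_cons, eval_cons, ← ih]
    obtain _ | t := l
    · rfl
    · fin_cases t <;> rfl

theorem growth_le_growth_product {I : Type} (G : I → MarkedGroup) (i : I) (n : ℕ) :
    growth (G i).gens n ≤ growth (product G).gens n :=
  growth_le_growth_of_translation id (fun _ h => h) fun u v h => by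
    rw [← product_eval_apply, ← product_eval_apply]
    exact congrFun (congrArg Subtype.val h) i

end MarkedGroup

/-! ### Reduced words -/

/-- A word is reduced if the letter `a` alternates with the letters `b`, `c`, `d`. -/
def IsReducedWord (w : List MarkingLetter) : Prop :=
  w.IsChain fun l l' => l.isSome ≠ l'.isSome

/-- Every word can be reduced, without lengthening it, by relations valid in all marked groups. -/
theorem exists_isReducedWord (w : List MarkingLetter) :
    ∃ w', IsReducedWord w' ∧ w'.length ≤ w.length ∧ ∀ H : MarkedGroup, H.eval w' = H.eval w := by
  induction w with
  | nil => exact ⟨[], List.isChain_nil, le_rfl, fun _ => rfl⟩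
  | cons l w ih =>
    obtain ⟨w', hred, hlen, heval⟩ := ih
    simp only [MarkedGroup.eval_cons, ← heval, List.length_cons]
    match w' with
    | [] => exact ⟨[l], List.isChain_singleton _, by simp, by simp⟩
    | l' :: v =>
      have hv : IsReducedWord v := List.IsChain.tail hred
      rw [List.length_cons] at hlen
      by_cases hll : l = l'
      · subst hll
        exact ⟨v, hv, by omega, fun H => by
          rw [MarkedGroup.eval_cons, ← mul_assoc, H.letter_mul_self, one_mul]⟩
      by_cases hs : l.isSome = l'.isSome
      · obtain _ | s := l
        · obtain _ | t := l'
          · exact absurd rfl hll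
          · simp at hs
        obtain _ | t := l'
        · simp at hs
        refine ⟨some (-(s + t)) :: v, ?_, by simp only [List.length_cons]; omega, fun H => ?_⟩
        · match v with
          | [] => exact List.isChain_singleton _
          | l'' :: v' =>
            obtain ⟨h1, h2⟩ := List.isChain_cons_cons.1 hred
            exact List.isChain_cons_cons.2 ⟨by simpa using h1, h2⟩
        · rw [MarkedGroup.eval_cons, MarkedGroup.eval_cons, ← mul_assoc,
            H.letter_mul_letter fun h => hll (congrArg some h)]
      · exact ⟨l :: l' :: v, List.isChain_cons_cons.2 ⟨hs, hred⟩,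
          by simp only [List.length_cons]; omega, fun H => by simp⟩

/-- About half of the letters of a reduced word are different from `a`; the summand depending on
the first letter makes the induction work. -/
theorem IsReducedWord.two_mul_countP_le :
    ∀ {w : List MarkingLetter}, IsReducedWord w →
      2 * w.countP Option.isSome ≤ w.length + if w.head?.any Option.isSome then 1 else 0
  | [], _ => by simp
  | [none], _ => by simp
  | [some _], _ => by simp
  | l :: l' :: w, h => by
    obtain ⟨h1, h2⟩ := List.isChain_cons_cons.1 h
    have ih := IsReducedWord.two_mul_countP_le (w := l' :: w) h2
    obtain _ | s := l <;> obtain _ | t := l' <;> simp at h1 ih ⊢ <;> omega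

/-! ### Sections of words -/

/-- The effect of a letter on the first level of the tree: `a` exchanges the two vertices. -/
def letterFlip (e : Bool) : MarkingLetter → Bool
  | none => !e
  | some _ => e

/-- The section of a letter at a vertex of the first level, as a word for the next level;
`false` is the first coordinate of the wreath product and `true` the second one. -/
def letterSection (x : Fin 3) : Bool → MarkingLetter → List MarkingLetter
  | _, none => []
  | false, some t => if x = t then [] else [none]
  | true, some t => [some t]

/-- The vertex of the first level that a word maps to the vertex `e`. -/
def wordFlip : Bool → List MarkingLetter → Bool
  | e, [] => e
  | e, l :: w => wordFlip (letterFlip e l) w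

/-- The section of a word with target the vertex `e` of the first level. -/
def wordSection (x : Fin 3) : Bool → List MarkingLetter → List MarkingLetter
  | _, [] => []
  | e, l :: w => letterSection x e l ++ wordSection x (letterFlip e l) w

theorem length_wordSection_le (x : Fin 3) (e : Bool) (w : List MarkingLetter) :
    (wordSection x e w).length ≤ w.countP Option.isSome := by
  induction w generalizing e with
  | nil => simp [wordSection]
  | cons l w ih =>
    have := ih (letterFlip e l)
    obtain _ | t := l
    · simpa [wordSection, letterSection] using this
    · have hle : (letterSection x e (some t)).length ≤ 1 := by
        cases e
        · rw [letterSection]; split_ifs <;> simp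
        · simp [letterSection]
      simp only [wordSection, List.length_append, List.countP_cons, Option.isSome_some, if_true]
      omega

namespace MarkedGroup

/-- The coordinate of the wreath product at an element of `C2`, as a vertex of the first level. -/
def vertexOf (q : C2) : Bool := decide (q ≠ 1)

theorem F_letter_left (x : Fin 3) (H : MarkedGroup) (l : MarkingLetter) (q : C2) :
    ((F x H).letter l).1.left q = H.eval (letterSection x (vertexOf q) l) := by
  obtain _ | t := l
  · cases vertexOf q <;> rfl
  · by_cases hq : q = 1
    · have hv : vertexOf q = false := by simp [vertexOf, hq]
      rw [hv, letterSection]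
      fin_cases t <;>
        · simp only [letter, F, ofGenerators, pair, hq, if_true]
          split_ifs <;> simp_all [letter]
    · have hv : vertexOf q = true := by simp [vertexOf, hq]
      rw [hv, letterSection]
      fin_cases t <;> simp [letter, F, ofGenerators, pair, hq]

theorem F_letter_right (x : Fin 3) (H : MarkedGroup) (l : MarkingLetter) (q : C2) :
    vertexOf ((((F x H).letter l).1.right)⁻¹ * q) = letterFlip (vertexOf q) l := by
  obtain _ | t := l
  · change vertexOf ((Multiplicative.ofAdd 1 : C2)⁻¹ * q) = !vertexOf q
    revert q
    decide
  · fin_cases t <;>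
      simp [letter, F, ofGenerators, pair, letterFlip]

/-- The coordinates of a word in the wreath product are its sections. -/
theorem F_eval (x : Fin 3) (H : MarkedGroup) (w : List MarkingLetter) (q : C2) :
    ((F x H).eval w).1.left q = H.eval (wordSection x (vertexOf q) w) ∧
      vertexOf ((((F x H).eval w).1.right)⁻¹ * q) = wordFlip (vertexOf q) w := by
  induction w generalizing q with
  | nil => exact ⟨rfl, congrArg vertexOf (show (1 : C2)⁻¹ * q = q by simp)⟩
  | cons l w ih =>
    have h := ih ((((F x H).letter l).1.right)⁻¹ * q)
    rw [F_letter_right] at h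
    rw [eval_cons]
    constructor
    · rw [wordSection, eval_append, ← h.1, ← F_letter_left]
      rfl
    · rw [wordFlip, ← h.2, ← mul_assoc, ← mul_inv_rev]
      rfl

/-- A word that fixes the first level and has trivial sections is trivial in `F x H`. -/
theorem F_eval_eq_one (x : Fin 3) (H : MarkedGroup) (w : List MarkingLetter)
    (hflip : wordFlip false w = false) (hsec : ∀ e, H.eval (wordSection x e w) = 1) :
    (F x H).eval w = 1 := by
  refine Subtype.ext (RegularWreathProduct.ext (funext fun q => ?_) ?_)
  · rw [(F_eval x H w q).1, hsec]
    rfl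
  · have h := (F_eval x H w 1).2
    rw [mul_one, show vertexOf 1 = false by simp [vertexOf], hflip] at h
    have h' : (((F x H).eval w).1.right)⁻¹ = 1 := by simpa only [vertexOf, decide_eq_false_iff_not,
      not_not] using h
    exact inv_eq_one.1 h'

end MarkedGroup

theorem grigorchuk_letter_apply (ω : ℕ → Fin 3) (l : MarkingLetter) (e : Bool) (v : List Bool) :
    ((grigorchuk ω).letter l).1 (letterFlip e l :: v) =
      e :: ((grigorchuk fun n => ω (n + 1)).eval (letterSection (ω 0) e l)).1 v := by
  obtain _ | t := l
  · have key (v : List Bool) : ((grigorchuk ω).letter none).1 v = treeFlip v := rfl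
    rw [key]
    simp only [treeFlip, letterFlip, letterSection, Bool.not_not, MarkedGroup.eval_nil]
    rfl
  · have key (ω : ℕ → Fin 3) (v : List Bool) :
        ((grigorchuk ω).letter (some t)).1 v = treeBranch t ω v := by
      fin_cases t <;> rfl
    rw [key]
    cases e
    · simp only [letterFlip, treeBranch, letterSection]
      split_ifs
      · rfl
      · simp only [MarkedGroup.eval_cons, MarkedGroup.eval_nil, mul_one]
        rfl
    · simp only [letterFlip, treeBranch, letterSection, MarkedGroup.eval_cons,
        MarkedGroup.eval_nil, mul_one, key]

/-- The action of a word on the tree is given by the same sections as its coordinates in `F x H`. -/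
theorem grigorchuk_eval_apply (ω : ℕ → Fin 3) (w : List MarkingLetter) (e : Bool)
    (v : List Bool) :
    ((grigorchuk ω).eval w).1 (wordFlip e w :: v) =
      e :: ((grigorchuk fun n => ω (n + 1)).eval (wordSection (ω 0) e w)).1 v := by
  induction w generalizing e v with
  | nil => rfl
  | cons l w ih =>
    rw [MarkedGroup.eval_cons, wordFlip, wordSection, MarkedGroup.eval_append]
    change ((grigorchuk ω).letter l).1 (((grigorchuk ω).eval w).1 _) = _
    rw [ih, grigorchuk_letter_apply]
    rfl

theorem wordFlip_eq_of_grigorchuk_eval_eq_one {ω : ℕ → Fin 3} {w : List MarkingLetter}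
    (h : (grigorchuk ω).eval w = 1) (e : Bool) : wordFlip e w = e := by
  have := grigorchuk_eval_apply ω w e []
  rw [h] at this
  exact (List.cons_eq_cons.1 this).1

theorem grigorchuk_eval_wordSection_eq_one {ω : ℕ → Fin 3} {w : List MarkingLetter}
    (h : (grigorchuk ω).eval w = 1) (e : Bool) :
    (grigorchuk fun n => ω (n + 1)).eval (wordSection (ω 0) e w) = 1 := by
  refine Subtype.ext (Equiv.ext fun v => ?_)
  have := grigorchuk_eval_apply ω w e v
  rw [h] at this
  exact (List.cons_eq_cons.1 this).2.symm

/-! ### Comparison with the Grigorchuk group -/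

theorem exists_treeBranch_ne (t : Fin 3) (n : ℕ) (ω : ℕ → Fin 3) (h : ω n ≠ t) :
    ∃ v, treeBranch t ω v ≠ v := by
  induction n generalizing ω with
  | zero => exact ⟨[false, false], by simp [treeBranch, h, treeFlip]⟩
  | succ n ih =>
    obtain ⟨v, hv⟩ := ih (fun n => ω (n + 1)) h
    exact ⟨true :: v, by simpa [treeBranch] using hv⟩

theorem NonStabilizing.shift {ω : ℕ → Fin 3} (h : NonStabilizing ω) :
    NonStabilizing fun n => ω (n + 1) := fun x N => by
  obtain ⟨n, hn, hx⟩ := h x (N + 1)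
  obtain ⟨k, rfl⟩ : ∃ k, n = k + 1 := ⟨n - 1, by omega⟩
  exact ⟨k, by omega, hx⟩

theorem NonStabilizing.grigorchuk_letter_ne_one {ω : ℕ → Fin 3} (h : NonStabilizing ω)
    (l : MarkingLetter) : (grigorchuk ω).letter l ≠ 1 := by
  intro hl
  have hfix (v : List Bool) : ((grigorchuk ω).letter l).1 v = v := by rw [hl]; rfl
  obtain _ | t := l
  · have : treeFlip [false] = [false] := hfix [false]
    simp [treeFlip] at this
  · obtain ⟨n, -, hn⟩ := h t 0
    obtain ⟨v, hv⟩ := exists_treeBranch_ne t n ω hn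
    refine hv ((Eq.symm ?_).trans (hfix v))
    fin_cases t <;> rfl

/-- Every relation of length at most `2 ^ m` of the Grigorchuk group holds in `F^m_ω (H)`, for
every marked group `H`: the sections of a reduced word have about half its length, and
a relation of length at most one in a Grigorchuk group is empty. -/
theorem Fpow_eval_eq_one_of_grigorchuk (m : ℕ) {ω : ℕ → Fin 3} (hω : NonStabilizing ω)
    (H : MarkedGroup) (w : List MarkingLetter) (hw : w.length ≤ 2 ^ m)
    (h : (grigorchuk ω).eval w = 1) : (MarkedGroup.Fpow ω m H).eval w = 1 := by
  induction m generalizing ω w with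
  | zero =>
    match w with
    | [] => rfl
    | [l] => exact absurd (by simpa using h) (hω.grigorchuk_letter_ne_one l)
    | _ :: _ :: _ => simp at hw
  | succ m ih =>
    obtain ⟨w', hred, hlen, heval⟩ := exists_isReducedWord w
    rw [← heval] at h ⊢
    refine MarkedGroup.F_eval_eq_one _ _ _ (wordFlip_eq_of_grigorchuk_eval_eq_one h false)
      fun e => ih hω.shift _ ?_ (grigorchuk_eval_wordSection_eq_one h e)
    have h1 := length_wordSection_le (ω 0) e w'
    have h2 := hred.two_mul_countP_le
    have h3 : (if w'.head?.any Option.isSome then 1 else 0) ≤ 1 := by split_ifs <;> simp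
    rw [pow_succ] at hw
    omega

theorem Fpow_eval_eq_of_grigorchuk {m : ℕ} {ω : ℕ → Fin 3} (hω : NonStabilizing ω)
    (H : MarkedGroup) {n : ℕ} (hn : 2 * n ≤ 2 ^ m) {u v : List MarkingLetter}
    (hu : u.length ≤ n) (hv : v.length ≤ n)
    (h : (grigorchuk ω).eval u = (grigorchuk ω).eval v) :
    (MarkedGroup.Fpow ω m H).eval u = (MarkedGroup.Fpow ω m H).eval v := by
  rw [← MarkedGroup.eval_reverse_append_eq_one_iff] at h ⊢
  exact Fpow_eval_eq_one_of_grigorchuk m hω H _ (by simp; omega) h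

/-- If all but the first `k` factors satisfy the relations of length `2 * n` of the Grigorchuk
group, then the `n`-ball of the marked product embeds into the product of the first `k` factors
and the `n`-ball of the Grigorchuk group. -/
theorem growth_product_le (ω : ℕ → Fin 3) (hω : NonStabilizing ω) (m : ℕ → ℕ)
    (H : ℕ → MarkedGroup) (k n : ℕ)
    (hfin : ∀ i, Finite (MarkedGroup.Fpow ω (m i) (H i)).carrier)
    (hm : ∀ i, k ≤ i → 2 * n ≤ 2 ^ m i) :
    growth (MarkedGroup.product fun i => MarkedGroup.Fpow ω (m i) (H i)).gens n ≤
      (∏ i ∈ Finset.range k, Nat.card (MarkedGroup.Fpow ω (m i) (H i)).carrier) *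
        growth (grigorchuk ω).gens n := by
  set G := fun i => MarkedGroup.Fpow ω (m i) (H i) with hG
  rw [growth, growth, MarkedGroup.wordBall_gens, MarkedGroup.wordBall_gens,
    ← Fin.prod_univ_eq_prod_range (fun i => Nat.card (G i).carrier), ← Nat.card_pi,
    ← Set.ncard_univ, ← Set.ncard_prod]
  refine (Set.ncard_image_le_ncard_image (MarkedGroup.finite_words n)
    (g := fun w => ((fun i : Fin k => (G i).eval w), (grigorchuk ω).eval w)) ?_).trans
    (Set.ncard_le_ncard ?_ (Set.finite_univ.prod ((MarkedGroup.finite_words n).image _)))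
  · intro u hu v hv huv
    rw [Prod.mk.injEq] at huv
    refine Subtype.ext (funext fun i => ?_)
    rw [MarkedGroup.product_eval_apply, MarkedGroup.product_eval_apply]
    obtain hi | hi := lt_or_ge i k
    · exact congrFun huv.1 ⟨i, hi⟩
    · exact Fpow_eval_eq_of_grigorchuk hω _ (hm i hi) hu hv huv.2
  · rintro _ ⟨w, hw, rfl⟩
    exact ⟨Set.mem_univ _, w, hw, rfl⟩

/-! ### Growth passes from `H` to `F^m_ω (H)` -/

namespace MarkedGroup

theorem finite_F (x : Fin 3) (H : MarkedGroup) [Finite H.carrier] : Finite (F x H).carrier :=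
  Subtype.finite (α := RegularWreathProduct H.carrier C2)

theorem finite_Fpow (ω : ℕ → Fin 3) (m : ℕ) (H : MarkedGroup) [Finite H.carrier] :
    Finite (Fpow ω m H).carrier := by
  induction m generalizing ω with
  | zero => assumption
  | succ m ih =>
    have := ih fun n => ω (n + 1)
    exact finite_F _ _

/-- A word for `F x H` fixing the second coordinate, whose section there is the given letter:
`a` is the first coordinate of a generator other than the one for `x`, and conjugation by `a`
exchanges the coordinates. -/
def liftLetter (x : Fin 3) : MarkingLetter → List MarkingLetter
  | none => [none, some (x + 1), none]
  | some t => [some t]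

theorem wordSection_liftLetter (x : Fin 3) (w : List MarkingLetter) :
    wordSection x true (w.flatMap (liftLetter x)) = w := by
  induction w with
  | nil => rfl
  | cons l w ih =>
    obtain _ | t := l
    · simpa [liftLetter, wordSection, letterFlip, letterSection] using ih
    · simpa [liftLetter, wordSection, letterFlip, letterSection] using ih

theorem length_flatMap_liftLetter_le (x : Fin 3) (w : List MarkingLetter) :
    (w.flatMap (liftLetter x)).length ≤ 3 * w.length := by
  induction w with
  | nil => simp
  | cons l w ih =>
    obtain _ | t := l <;> simp [liftLetter] at ih ⊢ <;> omega

theorem growth_le_growth_F (x : Fin 3) (H : MarkedGroup) (n : ℕ) :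
    growth H.gens n ≤ growth (F x H).gens (3 * n) := by
  refine growth_le_growth_of_translation (fun w => w.flatMap (liftLetter x))
    (fun w hw => (length_flatMap_liftLetter_le x w).trans (by omega)) fun u v h => ?_
  have key (w : List MarkingLetter) :
      ((F x H).eval (w.flatMap (liftLetter x))).1.left (Multiplicative.ofAdd 1) = H.eval w := by
    rw [(F_eval x H _ _).1, show vertexOf (Multiplicative.ofAdd 1) = true by decide,
      wordSection_liftLetter]
  rw [← key u, ← key v, h]

theorem growth_le_growth_Fpow (ω : ℕ → Fin 3) (m : ℕ) (H : MarkedGroup) (n : ℕ) :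
    growth H.gens n ≤ growth (Fpow ω m H).gens (3 ^ m * n) := by
  induction m generalizing ω with
  | zero => rw [pow_zero, one_mul, Fpow]
  | succ m ih =>
    refine (ih fun n => ω (n + 1)).trans ((growth_le_growth_F (ω 0) _ _).trans_eq ?_)
    rw [pow_succ', mul_assoc]
    rfl

end MarkedGroup

/-! ### A marking of `PSL₂(p)` -/

namespace PSLMarking

open Matrix

section Matrices

variable {K : Type} [Field K]

/-- The upper unitriangular matrix with entry `x`. -/
def upper (x : K) : Matrix.SpecialLinearGroup (Fin 2) K := ⟨!![1, x; 0, 1], by simp⟩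

/-- The lower unitriangular matrix with entry `x`. -/
def lower (x : K) : Matrix.SpecialLinearGroup (Fin 2) K := ⟨!![1, 0; x, 1], by simp⟩

/-- A lift of the generator `a`, for `j` a square root of `-1`. -/
def matA (j : K) (hj : j * j = -1) : Matrix.SpecialLinearGroup (Fin 2) K :=
  ⟨!![j, -j; 0, -j], by simp [hj]⟩

/-- A lift of the generator `b`. -/
def matB : Matrix.SpecialLinearGroup (Fin 2) K := ⟨!![0, 1; -1, 0], by simp⟩

/-- A lift of the generator `c`, for `j` a square root of `-1`. -/
def matC (j : K) (hj : j * j = -1) : Matrix.SpecialLinearGroup (Fin 2) K :=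
  ⟨!![0, j; j, 0], by simp [hj]⟩

/-- A lift of the generator `d`, for `j` a square root of `-1`. -/
def matD (j : K) (hj : j * j = -1) : Matrix.SpecialLinearGroup (Fin 2) K :=
  ⟨!![j, 0; 0, -j], by simp [hj]⟩

@[simp] theorem coe_upper (x : K) :
    (upper x : Matrix (Fin 2) (Fin 2) K) = !![1, x; 0, 1] := rfl

@[simp] theorem coe_lower (x : K) :
    (lower x : Matrix (Fin 2) (Fin 2) K) = !![1, 0; x, 1] := rfl

@[simp] theorem coe_matB : ((matB : Matrix.SpecialLinearGroup (Fin 2) K) :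
    Matrix (Fin 2) (Fin 2) K) = !![0, 1; -1, 0] := rfl

variable {j : K} (hj : j * j = -1)

@[simp] theorem coe_matA : (matA j hj : Matrix (Fin 2) (Fin 2) K) = !![j, -j; 0, -j] := rfl

@[simp] theorem coe_matC : (matC j hj : Matrix (Fin 2) (Fin 2) K) = !![0, j; j, 0] := rfl

@[simp] theorem coe_matD : (matD j hj : Matrix (Fin 2) (Fin 2) K) = !![j, 0; 0, -j] := rfl

theorem matA_mul_self : matA j hj * matA j hj = -1 := by
  ext r s; fin_cases r <;> fin_cases s <;> simp [hj]

theorem matB_mul_self : (matB : Matrix.SpecialLinearGroup (Fin 2) K) * matB = -1 := by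
  ext r s; fin_cases r <;> fin_cases s <;> simp

theorem matC_mul_self : matC j hj * matC j hj = -1 := by
  ext r s; fin_cases r <;> fin_cases s <;> simp [hj]

theorem matD_mul_self : matD j hj * matD j hj = -1 := by
  ext r s; fin_cases r <;> fin_cases s <;> simp [hj]

theorem matB_mul_matC_mul_matD : matB * matC j hj * matD j hj = -1 := by
  ext r s; fin_cases r <;> fin_cases s <;> simp [hj]

theorem upper_one_eq : upper (1 : K) = -1 * (matA j hj * matD j hj) := by
  ext r s; fin_cases r <;> fin_cases s <;> simp [hj]

theorem upper_mul_upper (x y : K) : upper x * upper y = upper (x + y) := by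
  ext r s; fin_cases r <;> fin_cases s <;> simp [add_comm]

theorem matB_mul_upper (x : K) : matB * upper x = lower (-x) * matB := by
  ext r s; fin_cases r <;> fin_cases s <;> simp

theorem lower_one_eq : lower (1 : K) = matB * (matD j hj * (matA j hj * matB)) := by
  ext r s; fin_cases r <;> fin_cases s <;> simp [hj]

theorem eq_upper_mul_lower_mul_upper (M : Matrix.SpecialLinearGroup (Fin 2) K)
    (h : (M : Matrix (Fin 2) (Fin 2) K) 1 0 ≠ 0) :
    M = upper ((M.1 0 0 - 1) / M.1 1 0) * lower (M.1 1 0) * upper ((M.1 1 1 - 1) / M.1 1 0) := by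
  have hdet := M.2
  rw [det_fin_two] at hdet
  ext r s
  fin_cases r <;> fin_cases s <;> simp <;> field_simp <;>
    first | ring1 | linear_combination -hdet

end Matrices

/-- The projection `SL₂(p) → PSL₂(p)`. -/
def proj (p : ℕ) : Matrix.SpecialLinearGroup (Fin 2) (ZMod p) →*
    ProjectiveSpecialLinearGroup (Fin 2) (ZMod p) :=
  QuotientGroup.mk' _

theorem proj_neg_one (p : ℕ) : proj p (-1) = 1 :=
  (QuotientGroup.eq_one_iff _).2 (Subgroup.mem_center_iff.2 fun M => by simp)

variable {p : ℕ} [Fact p.Prime] {j : ZMod p} (hj : j * j = -1)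

/-- A subgroup of `SL₂(p)` containing the lifts of `a`, `b`, `d` contains the unitriangular
matrices with entry `1`, hence all elementary matrices because the field is prime. -/
theorem subgroup_eq_top (L : Subgroup (Matrix.SpecialLinearGroup (Fin 2) (ZMod p)))
    (ha : matA j hj ∈ L) (hb : matB ∈ L) (hd : matD j hj ∈ L) : L = ⊤ := by
  have hneg : (-1 : Matrix.SpecialLinearGroup (Fin 2) (ZMod p)) ∈ L :=
    (matB_mul_self (K := ZMod p)) ▸ L.mul_mem hb hb
  have hone : upper (1 : ZMod p) ∈ L :=
    upper_one_eq hj ▸ L.mul_mem hneg (L.mul_mem ha hd)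
  have hupper (x : ZMod p) : upper x ∈ L := by
    have hnat (n : ℕ) : upper (n : ZMod p) ∈ L := by
      induction n with
      | zero =>
        have : upper ((0 : ℕ) : ZMod p) = 1 := by
          ext r s; fin_cases r <;> fin_cases s <;> simp
        exact this ▸ L.one_mem
      | succ n ih => rw [Nat.cast_succ, ← upper_mul_upper]; exact L.mul_mem ih hone
    simpa using hnat x.val
  have hlower (x : ZMod p) : lower x ∈ L := by
    have h := matB_mul_upper (-x)
    rw [neg_neg, ← mul_inv_eq_iff_eq_mul] at h
    exact h ▸ L.mul_mem (L.mul_mem hb (hupper _)) (L.inv_mem hb)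
  have hbig (M : Matrix.SpecialLinearGroup (Fin 2) (ZMod p))
      (h : (M : Matrix (Fin 2) (Fin 2) (ZMod p)) 1 0 ≠ 0) : M ∈ L := by
    rw [eq_upper_mul_lower_mul_upper M h]
    exact L.mul_mem (L.mul_mem (hupper _) (hlower _)) (hupper _)
  refine (Subgroup.eq_top_iff' L).2 fun M => ?_
  by_cases h : (M : Matrix (Fin 2) (Fin 2) (ZMod p)) 1 0 = 0
  · have hdet := M.2
    rw [det_fin_two, h, mul_zero, sub_zero] at hdet
    have h0 : (M : Matrix (Fin 2) (Fin 2) (ZMod p)) 0 0 ≠ 0 := left_ne_zero_of_mul_eq_one hdet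
    refine (L.mul_mem_cancel_left hb).1 (hbig _ ?_)
    simpa [mul_apply, Fin.sum_univ_two] using h0
  · exact hbig M h

/-- The marking of `PSL₂(p)` attached to a square root `j` of `-1`. The generators `b`, `c`, `d`
form a Klein four-group, and `a` is chosen so that `a * d` is unipotent. -/
def markedPSL : MarkedGroup where
  carrier := ProjectiveSpecialLinearGroup (Fin 2) (ZMod p)
  a := proj p (matA j hj)
  b := proj p matB
  c := proj p (matC j hj)
  d := proj p (matD j hj)
  a_sq := by rw [← map_mul, matA_mul_self, proj_neg_one]
  b_sq := by rw [← map_mul, matB_mul_self, proj_neg_one]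
  c_sq := by rw [← map_mul, matC_mul_self, proj_neg_one]
  d_sq := by rw [← map_mul, matD_mul_self, proj_neg_one]
  bcd := by rw [← map_mul, ← map_mul, matB_mul_matC_mul_matD, proj_neg_one]
  closure_eq_top := by
    have hsurj : Function.Surjective (proj p) := QuotientGroup.mk'_surjective _
    refine Subgroup.comap_injective hsurj ?_
    rw [Subgroup.comap_top]
    exact subgroup_eq_top hj _ (Subgroup.subset_closure (by simp))
      (Subgroup.subset_closure (by simp)) (Subgroup.subset_closure (by simp))

/-- The vector with natural entries obtained from `(1, 1)` by the unitriangular matrices with entry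
`1` listed in a word, `true` standing for the upper one. -/
def euclidVec : List Bool → ℕ × ℕ
  | [] => (1, 1)
  | true :: s => ((euclidVec s).1 + (euclidVec s).2, (euclidVec s).2)
  | false :: s => ((euclidVec s).1, (euclidVec s).1 + (euclidVec s).2)

theorem euclidVec_pos (s : List Bool) : 0 < (euclidVec s).1 ∧ 0 < (euclidVec s).2 := by
  induction s with
  | nil => simp [euclidVec]
  | cons t s ih => cases t <;> simp only [euclidVec] <;> omega

theorem euclidVec_le (s : List Bool) :
    (euclidVec s).1 ≤ 2 ^ s.length ∧ (euclidVec s).2 ≤ 2 ^ s.length := by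
  induction s with
  | nil => simp [euclidVec]
  | cons t s ih => cases t <;> simp only [euclidVec, List.length_cons, pow_succ] <;> omega

/-- The word is recovered from the vector by the subtractive Euclidean algorithm. -/
theorem euclidVec_injective : Function.Injective euclidVec := by
  intro s
  induction s with
  | nil =>
    intro s' h
    match s' with
    | [] => rfl
    | t :: s' =>
      have := euclidVec_pos s'
      cases t <;> simp only [euclidVec, Prod.mk.injEq] at h <;> omega
  | cons t s ih =>
    intro s' h
    have h1 := euclidVec_pos s
    match s' with
    | [] => cases t <;> simp only [euclidVec, Prod.mk.injEq] at h <;> omega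
    | t' :: s' =>
      have h2 := euclidVec_pos s'
      have key : t = t' ∧ euclidVec s = euclidVec s' := by
        rw [Prod.ext_iff]
        cases t <;> cases t' <;> simp only [euclidVec, Prod.mk.injEq] at h ⊢ <;>
          simp <;> omega
      rw [key.1, ih key.2]

/-- The product of the unitriangular matrices with entry `1` listed in a word. -/
def unitriangularProd (p : ℕ) [Fact p.Prime] (s : List Bool) :
    Matrix.SpecialLinearGroup (Fin 2) (ZMod p) :=
  (s.map fun t => if t then upper 1 else lower 1).prod

theorem unitriangularProd_mulVec (s : List Bool) :
    (unitriangularProd p s : Matrix (Fin 2) (Fin 2) (ZMod p)) *ᵥ ![1, 1] =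
      ![((euclidVec s).1 : ZMod p), ((euclidVec s).2 : ZMod p)] := by
  induction s with
  | nil => simp [unitriangularProd, euclidVec]
  | cons t s ih =>
    have : unitriangularProd p (t :: s) =
        (if t then upper 1 else lower 1) * unitriangularProd p s := by simp [unitriangularProd]
    rw [this, Matrix.SpecialLinearGroup.coe_mul, ← mulVec_mulVec, ih]
    cases t <;> ext r <;> fin_cases r <;>
      simp [euclidVec, mulVec, dotProduct, Fin.sum_univ_two]

theorem natCast_eq_of_lt {x y : ℕ} (hx : x < p) (hy : y < p) (h : (x : ZMod p) = y) : x = y := by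
  rwa [ZMod.natCast_eq_natCast_iff', Nat.mod_eq_of_lt hx, Nat.mod_eq_of_lt hy] at h

/-- The images of `(1, 1)` have positive entries at most `2 ^ k`, too small to be congruent modulo
`p` up to sign unless they are equal. -/
theorem proj_unitriangularProd_injective {s s' : List Bool}
    (hs : 2 ^ (s.length + 1) < p) (hs' : 2 ^ (s'.length + 1) < p)
    (h : proj p (unitriangularProd p s) = proj p (unitriangularProd p s')) : s = s' := by
  have hz := QuotientGroup.eq.1 h
  obtain ⟨r, hr, hrz⟩ := Matrix.SpecialLinearGroup.mem_center_iff.1 hz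
  have hM : (unitriangularProd p s' : Matrix (Fin 2) (Fin 2) (ZMod p)) =
      (unitriangularProd p s : Matrix (Fin 2) (Fin 2) (ZMod p)) * scalar (Fin 2) r := by
    rw [hrz, ← Matrix.SpecialLinearGroup.coe_mul, mul_inv_cancel_left]
  have hv := unitriangularProd_mulVec (p := p) s'
  have hscal : scalar (Fin 2) r *ᵥ ![1, 1] = r • ![1, 1] := by
    ext k; fin_cases k <;> simp
  rw [hM, ← mulVec_mulVec, hscal, mulVec_smul, unitriangularProd_mulVec] at hv
  have h0 := congrFun hv 0
  have h1 := congrFun hv 1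
  simp only [Pi.smul_apply, smul_eq_mul, cons_val_zero, cons_val_one] at h0 h1
  have p1 := euclidVec_pos s
  have p2 := euclidVec_pos s'
  have l1 := euclidVec_le s
  have l2 := euclidVec_le s'
  rw [pow_succ] at hs hs'
  rw [Fintype.card_fin, sq, mul_self_eq_one_iff] at hr
  obtain rfl | rfl := hr
  · rw [one_mul] at h0 h1
    exact euclidVec_injective (Prod.ext (natCast_eq_of_lt (by omega) (by omega) h0)
      (natCast_eq_of_lt (by omega) (by omega) h1))
  · -- the sum of the first entries would be a positive multiple of `p` below `p`
    exfalso
    have hsum : (((euclidVec s).1 + (euclidVec s').1 : ℕ) : ZMod p) = (0 : ℕ) := by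
      push_cast
      rw [← h0]
      ring
    have := natCast_eq_of_lt (by omega) (by omega) hsum
    omega

/-- The words in the marking for the two unitriangular matrices with entry `1`. -/
def unitriangularWord : Bool → List MarkingLetter
  | true => [none, some 0]
  | false => [some 2, some 0, none, some 2]

theorem markedPSL_eval (s : List Bool) :
    (markedPSL hj).eval (s.flatMap unitriangularWord) = proj p (unitriangularProd p s) := by
  induction s with
  | nil => simp [unitriangularProd]; rfl
  | cons t s ih =>
    have : unitriangularProd p (t :: s) =
        (if t then upper 1 else lower 1) * unitriangularProd p s := by simp [unitriangularProd]
    rw [List.flatMap_cons, MarkedGroup.eval_append, ih, this, map_mul]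
    congr 1
    cases t
    · rw [if_neg (by simp), lower_one_eq hj]
      simp only [map_mul, unitriangularWord, MarkedGroup.eval_cons, MarkedGroup.eval_nil, mul_one]
      rfl
    · rw [if_pos rfl, upper_one_eq hj, map_mul, proj_neg_one, one_mul]
      simp only [map_mul, unitriangularWord, MarkedGroup.eval_cons, MarkedGroup.eval_nil, mul_one]
      rfl

theorem two_pow_le_growth_markedPSL {k : ℕ} (hk : 2 ^ (k + 1) < p) :
    2 ^ k ≤ growth (markedPSL hj).gens (4 * k) := by
  have hcard : Nat.card (List.Vector Bool k) = 2 ^ k := by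
    rw [Nat.card_eq_fintype_card, card_vector, Fintype.card_bool]
  have hfin := (markedPSL hj).finite_wordBall (4 * k)
  have hlen (s : List Bool) : (s.flatMap unitriangularWord).length ≤ 4 * s.length := by
    induction s with
    | nil => simp
    | cons t s ih => cases t <;> simp [unitriangularWord] at ih ⊢ <;> omega
  have hmem (s : List.Vector Bool k) : (markedPSL hj).eval (s.1.flatMap unitriangularWord) ∈
      wordBall (markedPSL hj).gens (4 * k) := by
    rw [MarkedGroup.wordBall_gens]
    exact ⟨_, (hlen s.1).trans_eq (by rw [s.2]), rfl⟩
  have := hfin.to_subtype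
  rw [← hcard, growth, ← Nat.card_coe_set_eq]
  refine Nat.card_le_card_of_injective (fun s => ⟨_, hmem s⟩) fun s s' h => Subtype.ext ?_
  have h' := congrArg Subtype.val h
  simp only [markedPSL_eval] at h'
  exact proj_unitriangularProd_injective (by rwa [s.2]) (by rwa [s'.2]) h'

end PSLMarking

theorem exists_marking_PSL {p : ℕ} (hp : p.Prime) (hp4 : p % 4 = 1) :
    ∃ H : MarkedGroup, Finite H.carrier ∧
      Nonempty (H.carrier ≃* Matrix.ProjectiveSpecialLinearGroup (Fin 2) (ZMod p)) ∧
      ∀ k, 2 ^ (k + 1) < p → 2 ^ k ≤ growth H.gens (4 * k) := by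
  have : Fact p.Prime := ⟨hp⟩
  obtain ⟨j, hj⟩ := ZMod.exists_sq_eq_neg_one_iff.2 (show p % 4 ≠ 3 by omega)
  refine ⟨PSLMarking.markedPSL hj.symm, ?_, ⟨MulEquiv.refl _⟩, fun k hk =>
    PSLMarking.two_pow_le_growth_markedPSL hj.symm hk⟩
  exact Quotient.finite _

/-! ### Choice of the parameters -/

theorem exists_mem_range_of_eventually {a : ℕ → ℤ} (ha : Tendsto a atTop atTop) {P : ℕ → Prop}
    (hP : ∀ᶠ n in atTop, P n) (N : ℕ) : ∃ n, N ≤ n ∧ (n : ℤ) ∈ Set.range a ∧ P n := by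
  obtain ⟨M, hM⟩ := eventually_atTop.1 hP
  obtain ⟨i, hi⟩ := (ha.eventually_ge_atTop ((max M N : ℕ) : ℤ)).exists
  refine ⟨(a i).toNat, by omega, ⟨i, by omega⟩, hM _ (by omega)⟩

/-- A subexponential function is eventually below `2 ^ (n / c)`, rounded down. -/
theorem Admissible.eventually_lt_two_pow {f : ℕ → ℕ} (hf : Admissible fun n => (f n : ℝ)) {c : ℕ}
    (hc : 0 < c) : ∀ᶠ n in atTop, f n < 2 ^ (n / c) := by
  have hc' : (0 : ℝ) < c := by exact_mod_cast hc
  have hlog : 0 < Real.log 2 := Real.log_pos one_lt_two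
  filter_upwards [hf.subexponential.eventually_lt_const
    (show (0 : ℝ) < Real.log 2 / (2 * c) by positivity), eventually_ge_atTop c] with n hn hcn
  have hn0 : (0 : ℝ) < n := by exact_mod_cast hc.trans_le hcn
  by_contra! hle
  have hk : 1 ≤ n / c := (Nat.one_le_div_iff hc).2 hcn
  -- `n < (n / c + 1) * c ≤ 2 * (n / c) * c`
  have hnk : n ≤ 2 * (n / c) * c := by
    have h1 := Nat.lt_div_mul_add hc (a := n)
    nlinarith
  have hnk' : (n : ℝ) ≤ 2 * (n / c : ℕ) * c := by exact_mod_cast hnk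
  have h2 : ((n / c : ℕ) : ℝ) * Real.log 2 ≤ Real.log (f n) := by
    rw [← Real.log_pow]
    exact Real.log_le_log (by positivity) (by exact_mod_cast hle)
  rw [div_lt_div_iff₀ hn0 (by positivity)] at hn
  nlinarith

/-- One step of the construction: given lower bounds `M`, `P` and the order `C` of the product of
the previous factors, `m` is taken large for the upper bound, and then `p` large in terms of `m`
for the lower bound. -/
theorem exists_next_parameters {ω : ℕ → Fin 3} {f g : ℕ → ℕ}
    (hf : Admissible (fun n => (f n : ℝ)))
    (hlim : Tendsto (fun n => (g n : ℝ) / (growth (grigorchuk ω).gens n : ℝ)) atTop atTop)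
    {a b : ℕ → ℤ} (ha : Tendsto a atTop atTop) (hb : Tendsto b atTop atTop) (M P C : ℕ) :
    ∃ (m p : ℕ) (H : MarkedGroup), M < m ∧ P < p ∧
      (p.Prime ∧ p % 4 = 1 ∧
        Nonempty (H.carrier ≃* Matrix.ProjectiveSpecialLinearGroup (Fin 2) (ZMod p))) ∧
      Finite H.carrier ∧
      (∃ n, M ≤ n ∧ (n : ℤ) ∈ Set.range b ∧ C * growth (grigorchuk ω).gens n < g n ∧
        2 * n ≤ 2 ^ m) ∧
      ∃ n, M ≤ n ∧ (n : ℤ) ∈ Set.range a ∧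
        f n < growth (MarkedGroup.Fpow ω m H).gens n := by
  obtain ⟨n, hMn, hnb, hn⟩ := exists_mem_range_of_eventually hb
    (hlim.eventually_gt_atTop (C : ℝ)) M
  rw [lt_div_iff₀ (by exact_mod_cast MarkedGroup.growth_pos _ n)] at hn
  -- `m = M + 2 * n + 1` exceeds `M` and satisfies `2 * n ≤ 2 ^ m`
  set m := M + 2 * n + 1 with hm
  obtain ⟨n', hMn', hna, hn'⟩ := exists_mem_range_of_eventually ha
    (hf.eventually_lt_two_pow (show 0 < 3 ^ m * 4 by positivity)) M
  set k := n' / (3 ^ m * 4) with hk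
  obtain ⟨p, hp, hpgt, hp4⟩ := Nat.exists_prime_gt_modEq_one (P + 2 ^ (k + 1)) four_ne_zero
  have hp4' : p % 4 = 1 := hp4
  obtain ⟨H, hfin, hiso, hgrowth⟩ := exists_marking_PSL hp hp4'
  refine ⟨m, p, H, by omega, by omega, ⟨hp, hp4', hiso⟩, hfin,
    ⟨n, hMn, hnb, by exact_mod_cast hn, ?_⟩, n', hMn', hna, ?_⟩
  · exact (show 2 * n ≤ m by omega).trans Nat.lt_two_pow_self.le
  · calc f n' < 2 ^ k := hn'
      _ ≤ growth H.gens (4 * k) := hgrowth k (by omega)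
      _ ≤ growth (MarkedGroup.Fpow ω m H).gens (3 ^ m * (4 * k)) :=
        MarkedGroup.growth_le_growth_Fpow ω m H _
      _ ≤ _ := MarkedGroup.growth_mono _ (by rw [← mul_assoc]; exact Nat.mul_div_le _ _)

theorem theorem7p1 (ω : ℕ → Fin 3) (hω : NonStabilizing ω) (f g : ℕ → ℕ)
    (hf : Admissible (fun n => (f n : ℝ))) (hg : Admissible (fun n => (g n : ℝ)))
    (hlim : Tendsto (fun n => (g n : ℝ) / (growth (grigorchuk ω).gens n : ℝ)) atTop atTop)
    (a b : ℕ → ℤ) (ha : Tendsto a atTop atTop) (hb : Tendsto b atTop atTop) :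
    ∃ (Γ : Type) (_ : Group Γ) (S : Set Γ),
      S.Finite ∧ (∀ s ∈ S, s⁻¹ ∈ S) ∧ Subgroup.closure S = ⊤ ∧
      {n : ℕ | (n : ℤ) ∈ Set.range b ∧ growth S n < g n}.Infinite ∧
      {n : ℕ | (n : ℤ) ∈ Set.range a ∧ f n < growth S n}.Infinite ∧
      -- `Γ` is the marked product of the groups `F^{m i}_ω (H i)` with `H i` a marked `PSL₂(p i)`
      ∃ (m p : ℕ → ℕ) (H : ℕ → MarkedGroup),
        StrictMono m ∧ StrictMono p ∧
        (∀ i, (p i).Prime ∧ p i % 4 = 1 ∧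
          Nonempty ((H i).carrier ≃* Matrix.ProjectiveSpecialLinearGroup (Fin 2) (ZMod (p i)))) ∧
        ∃ e : Γ ≃* (MarkedGroup.product fun i => MarkedGroup.Fpow ω (m i) (H i)).carrier,
          e '' S = (MarkedGroup.product fun i => MarkedGroup.Fpow ω (m i) (H i)).gens := by
  choose m p H hm hp hH hfin hupper hlower using exists_next_parameters hf hlim ha hb
  -- The state consists of the last `m`, the last `p` and the order of the product of the groups
  -- chosen so far.
  let next : ℕ × ℕ × ℕ → ℕ × ℕ × ℕ := fun s =>
    (m s.1 s.2.1 s.2.2, p s.1 s.2.1 s.2.2,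
      s.2.2 * Nat.card (MarkedGroup.Fpow ω (m s.1 s.2.1 s.2.2) (H s.1 s.2.1 s.2.2)).carrier)
  let s : ℕ → ℕ × ℕ × ℕ := fun k => next^[k] (0, 0, 1)
  have hs (k : ℕ) : s (k + 1) = next (s k) := Function.iterate_succ_apply' _ _ _
  let m' (k : ℕ) : ℕ := m (s k).1 (s k).2.1 (s k).2.2
  let p' (k : ℕ) : ℕ := p (s k).1 (s k).2.1 (s k).2.2
  let H' (k : ℕ) : MarkedGroup := H (s k).1 (s k).2.1 (s k).2.2
  have hs1 (k : ℕ) : (s (k + 1)).1 = m' k := by rw [hs]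
  have hs2 (k : ℕ) : (s (k + 1)).2.1 = p' k := by rw [hs]
  have hmono : StrictMono m' := strictMono_nat_of_lt_succ fun k =>
    hs1 k ▸ hm (s (k + 1)).1 (s (k + 1)).2.1 (s (k + 1)).2.2
  have hpmono : StrictMono p' := strictMono_nat_of_lt_succ fun k =>
    hs2 k ▸ hp (s (k + 1)).1 (s (k + 1)).2.1 (s (k + 1)).2.2
  have hk (k : ℕ) : k ≤ (s k).1 := by
    induction k with
    | zero => exact Nat.zero_le _
    | succ k ih => exact hs1 k ▸ (ih.trans_lt (hm _ _ _))
  have hcard (k : ℕ) : (s k).2.2 =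
      ∏ i ∈ Finset.range k, Nat.card (MarkedGroup.Fpow ω (m' i) (H' i)).carrier := by
    induction k with
    | zero => rfl
    | succ k ih => rw [Finset.prod_range_succ, ← ih, hs]
  have hfinF (i : ℕ) : Finite (MarkedGroup.Fpow ω (m' i) (H' i)).carrier := by
    have := hfin (s i).1 (s i).2.1 (s i).2.2
    exact MarkedGroup.finite_Fpow ω _ _
  let G := MarkedGroup.product fun i => MarkedGroup.Fpow ω (m' i) (H' i)
  refine ⟨G.carrier, G.group, G.gens, ?_, ?_, G.closure_eq_top, ?_, ?_, m', p', H', hmono, hpmono,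
    fun i => hH _ _ _, MulEquiv.refl _, Set.image_id _⟩
  · rw [← G.range_letter]
    exact Set.finite_range _
  · rw [← G.range_letter]
    rintro _ ⟨l, rfl⟩
    exact ⟨l, (G.inv_letter l).symm⟩
  · refine Set.infinite_of_forall_exists_gt fun N => ?_
    obtain ⟨n, hn, hnb, hlt, hpow⟩ := hupper (s (N + 1)).1 (s (N + 1)).2.1 (s (N + 1)).2.2
    refine ⟨n, ⟨hnb, lt_of_le_of_lt ?_ hlt⟩, (hk (N + 1)).trans hn⟩
    rw [hcard]
    exact growth_product_le ω hω m' H' (N + 1) n hfinF fun i hi =>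
      hpow.trans (Nat.pow_le_pow_right two_pos (hmono.monotone hi))
  · refine Set.infinite_of_forall_exists_gt fun N => ?_
    obtain ⟨n, hn, hna, hlt⟩ := hlower (s (N + 1)).1 (s (N + 1)).2.1 (s (N + 1)).2.2
    exact ⟨n, ⟨hna, hlt.trans_le (MarkedGroup.growth_le_growth_product
      (fun i => MarkedGroup.Fpow ω (m' i) (H' i)) (N + 1) n)⟩, (hk (N + 1)).trans hn⟩
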